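/- Let $m \ge 0$ and $n, p \ge 1$ be integers and let $\gamma > 0$, $P \ge 0$ be real. Let $X$ be a random real $n\times p$ matrix and let $$Z = \Phi X + \gamma \Delta ,$$ where $\Phi$ is $m\times n$ with independent entries $\Phi_{ij}\sim N(0,1/n)$, $\Delta$ is $m\times p$ with independent entries $\Delta_{ij}\sim N(0,1)$, and $X$, $\Phi$, $\Delta$ are independent. Then the information rate satisfies $$r_{n,m} = \sup_{p(X)} \frac{I(X;Z)}{np} \;\le\; \frac{m}{n}\,\log\!\left(1+\frac{P}{\gamma^2}\right),$$ where the supremum is over all probability distributions of $X$ on $\mathbb{R}^{n\times p}$ (the entries may be dependent) that satisfy the power constraint $\frac1n\sum_{i=1}^n \mathbb{E}[X_{ij}^2]\le P$ for every column $j=1,\dots,p$. Here $I(X;Z)$ is the mutual information in nats, i.e. the Kullback–Leibler divergence of the joint law of $(X,Z)$ from the product of the laws of $X$ and $Z$, and $\log$ is the natural logarithm. -/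

import Mathlib

open MeasureTheory ProbabilityTheory
open scoped ENNReal NNReal

noncomputable section

/-- The product (Borel) σ-algebra on real matrices. -/
instance instMeasurableSpaceRealMatrix (m n : ℕ) :
    MeasurableSpace (Matrix (Fin m) (Fin n) ℝ) :=
  (MeasurableSpace.pi : MeasurableSpace (Fin m → Fin n → ℝ))

/-- The law of an `m × n` random matrix with independent entries distributed as `N(0, v)`. -/
def gaussianMatrix (m n : ℕ) (v : ℝ≥0) : Measure (Matrix (Fin m) (Fin n) ℝ) :=
  Measure.pi fun _ : Fin m => Measure.pi fun _ : Fin n => gaussianReal 0 v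

/-- The mutual information `I(X; Y)` (in nats) of two random variables on a probability space:
the Kullback-Leibler divergence of their joint law from the product of their laws. -/
def mutualInfo {Ω α β : Type*} [MeasurableSpace Ω] [MeasurableSpace α] [MeasurableSpace β]
    (ν : Measure Ω) (X : Ω → α) (Y : Ω → β) : ℝ≥0∞ :=
  InformationTheory.klDiv (ν.map fun ω => (X ω, Y ω)) ((ν.map X).prod (ν.map Y))

/-- `μ` is a probability law of an `n × p` random matrix `X` with square-integrable entries whose
columns satisfy the average power constraint `(1/n) ∑ᵢ E[X i j ^ 2] ≤ P`.
The entries of `X` may be dependent. -/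
structure PowerConstrained {n p : ℕ} (P : ℝ) (μ : Measure (Matrix (Fin n) (Fin p) ℝ)) :
    Prop where
  isProbabilityMeasure : IsProbabilityMeasure μ
  integrable_sq : ∀ i j, Integrable (fun X : Matrix (Fin n) (Fin p) ℝ => X i j ^ 2) μ
  power_le : ∀ j, (1 / (n : ℝ)) * ∑ i, ∫ X, X i j ^ 2 ∂μ ≤ P

/-- The joint law of the independent triple `(X, Φ, Δ)`, where `X` has law `μ`, `Φ` is `m × n` with
independent `N(0, 1/n)` entries, and `Δ` is `m × p` with independent `N(0, 1)` entries. -/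
def dataNoiseLaw {n p : ℕ} (m : ℕ) (μ : Measure (Matrix (Fin n) (Fin p) ℝ)) :
    Measure (Matrix (Fin n) (Fin p) ℝ × Matrix (Fin m) (Fin n) ℝ × Matrix (Fin m) (Fin p) ℝ) :=
  μ.prod ((gaussianMatrix m n (1 / (n : ℝ≥0))).prod (gaussianMatrix m p 1))

/-- The compressed data `Z = Φ X + γ Δ` as a function of `(X, Φ, Δ)`. -/
def compressedData {m n p : ℕ} (γ : ℝ)
    (ω : Matrix (Fin n) (Fin p) ℝ × Matrix (Fin m) (Fin n) ℝ × Matrix (Fin m) (Fin p) ℝ) :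
    Matrix (Fin m) (Fin p) ℝ :=
  ω.2.1 * ω.1 + γ • ω.2.2

/-- The information rate `sup_{p(X)} I(X; Z) / (n p)`, the supremum being over all laws of the
`n × p` data matrix `X` that satisfy the power constraint with bound `P`. -/
def informationRate (m n p : ℕ) (γ P : ℝ) : ℝ≥0∞ :=
  ⨆ (μ : Measure (Matrix (Fin n) (Fin p) ℝ)) (_ : PowerConstrained P μ),
    mutualInfo (dataNoiseLaw m μ) Prod.fst (compressedData γ) / ((n : ℝ≥0∞) * (p : ℝ≥0∞))

end

/-!
The information rate is bounded by comparing the law of the compressed data `Z = Φ X + γ Δ` with a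
Gaussian reference law.

For any probability law `Q`, the mutual information `I(X; Z)` is at most the divergence of the joint
law of `(X, Z)` from `law(X) ⊗ Q` (`klDiv_fst_prod_snd_le`, from the chain rule). By the data
processing inequality this is at most the divergence of the joint law of `((X, Φ), Z)` from
`law(X, Φ) ⊗ Q` (`mutualInfo_le_klDiv`): the sensing matrix may be revealed. Conditionally on
`(X, Φ)` the entries of `Z` are independent Gaussians with means `(Φ X) i j` and variance `γ ^ 2`,
so with `Q` the law of independent `N(0, P + γ ^ 2)` entries the density is explicit
(`map_compressedData_eq_withDensity`), and the divergence is the expectation of its logarithm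
(`klDiv_withDensity_exp`). That logarithm is quadratic in the entries of `Z` and `Δ`, so only their
second moments enter. Since the entries of `Φ` are centred and uncorrelated with variance `1 / n`,
the power constraint gives `E[Z i j ^ 2] ≤ P + γ ^ 2` (`compressedData_sq_moment`), whatever the
dependence between the entries of `X`. Each entry therefore contributes at most
`log (1 + P / γ ^ 2) / 2`, and `I(X; Z) ≤ (m p / 2) log (1 + P / γ ^ 2)`
(`mutualInfo_compressedData_le`), which is half of what the theorem asks for.
-/

/-! ### Kullback-Leibler divergence -/

/-- Among all product measures `ρ.fst.prod Q` the divergence from `ρ` is least when `Q` is the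
second marginal. By the chain rule along a disintegration of `ρ` over its second coordinate, the
two sides differ by the divergence of `ρ.snd` from `Q`, which is nonnegative. -/
theorem klDiv_fst_prod_snd_le {α β : Type*} [MeasurableSpace α] [MeasurableSpace β]
    [StandardBorelSpace α] [Nonempty α] (ρ : Measure (α × β)) [IsProbabilityMeasure ρ]
    (Q : Measure β) [IsProbabilityMeasure Q] :
    InformationTheory.klDiv ρ (ρ.fst.prod ρ.snd) ≤ InformationTheory.klDiv ρ (ρ.fst.prod Q) := by
  have hswap : ∀ τ : Measure β, SFinite τ → (τ.prod ρ.fst).map Prod.swap = ρ.fst.prod τ :=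
    fun τ _ => Measure.prod_swap
  have hρ : (ρ.map Prod.swap).map Prod.swap = ρ := by
    rw [Measure.map_map measurable_swap measurable_swap]; simp
  have hprob : IsProbabilityMeasure (ρ.map Prod.swap) :=
    Measure.isProbabilityMeasure_map measurable_swap.aemeasurable
  have hdis : ρ.snd ⊗ₘ (ρ.map Prod.swap).condKernel = ρ.map Prod.swap := by
    conv_rhs => rw [← (ρ.map Prod.swap).disintegrate (ρ.map Prod.swap).condKernel]
    rw [Measure.fst_map_swap]
  calc InformationTheory.klDiv ρ (ρ.fst.prod ρ.snd)
      = InformationTheory.klDiv ((ρ.map Prod.swap).map Prod.swap)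
          ((ρ.snd.prod ρ.fst).map Prod.swap) := by rw [hρ, hswap _ inferInstance]
    _ ≤ InformationTheory.klDiv (ρ.map Prod.swap) (ρ.snd.prod ρ.fst) :=
        InformationTheory.klDiv_map_le _ _ measurable_swap
    _ ≤ InformationTheory.klDiv (ρ.map Prod.swap) (Q.prod ρ.fst) := by
        have h := InformationTheory.klDiv_compProd_eq_add ρ.snd Q (ρ.map Prod.swap).condKernel
          (Kernel.const β ρ.fst)
        rw [hdis, Measure.compProd_const, Measure.compProd_const] at h
        rw [h]
        exact le_add_self
    _ = InformationTheory.klDiv (ρ.map Prod.swap) ((ρ.fst.prod Q).map Prod.swap) := by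
        rw [Measure.prod_swap]
    _ ≤ InformationTheory.klDiv ρ (ρ.fst.prod Q) :=
        InformationTheory.klDiv_map_le _ _ measurable_swap

theorem klDiv_withDensity_exp {α : Type*} [MeasurableSpace α] (μ ν : Measure α)
    [IsProbabilityMeasure μ] [IsProbabilityMeasure ν] {g : α → ℝ} (hg : Measurable g)
    (hμ : μ = ν.withDensity fun x => ENNReal.ofReal (Real.exp (g x))) (hint : Integrable g μ) :
    InformationTheory.klDiv μ ν = ENNReal.ofReal (∫ x, g x ∂μ) := by
  have hac : μ ≪ ν := hμ ▸ withDensity_absolutelyContinuous _ _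
  have hllr : llr μ ν =ᵐ[μ] g := by
    have h := Measure.rnDeriv_withDensity ν
      (f := fun x => ENNReal.ofReal (Real.exp (g x))) (by fun_prop)
    rw [← hμ] at h
    filter_upwards [hac.ae_le h] with x hx
    rw [llr, hx, ENNReal.toReal_ofReal (Real.exp_nonneg _), Real.log_exp]
  rw [InformationTheory.klDiv_of_ac_of_integrable hac (hint.congr hllr.symm),
    integral_congr_ae hllr]
  simp

/-! ### Densities of Gaussian product measures -/

/-- A product of measures with densities has the product density. -/
theorem pi_withDensity {ι : Type*} [Fintype ι] {E : ι → Type*} [∀ i, MeasurableSpace (E i)]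
    (μ : ∀ i, Measure (E i)) [∀ i, IsProbabilityMeasure (μ i)] (f : ∀ i, E i → ℝ≥0∞)
    (hf : ∀ i, Measurable (f i)) [∀ i, IsProbabilityMeasure ((μ i).withDensity (f i))] :
    Measure.pi (fun i => (μ i).withDensity (f i)) =
      (Measure.pi μ).withDensity fun x => ∏ i, f i (x i) := by
  refine Measure.pi_eq fun s hs => ?_
  rw [withDensity_apply _ (MeasurableSet.univ_pi hs),
    ← lintegral_indicator (MeasurableSet.univ_pi hs)]
  have hprod : ∀ x : ∀ i, E i, (Set.univ.pi s).indicator (fun x => ∏ i, f i (x i)) x =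
      ∏ i, (s i).indicator (f i) (x i) := by
    intro x
    by_cases hx : x ∈ Set.univ.pi s
    · rw [Set.indicator_of_mem hx]
      exact Finset.prod_congr rfl fun i _ => (Set.indicator_of_mem (hx i trivial) _).symm
    · rw [Set.indicator_of_notMem hx]
      simp only [Set.mem_pi, Set.mem_univ, true_implies, not_forall] at hx
      obtain ⟨i, hi⟩ := hx
      exact (Finset.prod_eq_zero (Finset.mem_univ i) (Set.indicator_of_notMem hi _)).symm
  have hm : ∀ i, Measurable ((s i).indicator (f i)) := fun i => (hf i).indicator (hs i)
  simp_rw [hprod]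
  have hind := lintegral_prod_eq_prod_lintegral_of_indepFun (μ := Measure.pi μ) Finset.univ
    (fun i x => (s i).indicator (f i) (x i)) (iIndepFun_pi fun i => (hm i).aemeasurable)
    fun i => (hm i).comp (measurable_pi_apply i)
  rw [hind]
  refine Finset.prod_congr rfl fun i _ => ?_
  rw [(measurePreserving_eval μ i).lintegral_comp (hm i), lintegral_indicator (hs i),
    withDensity_apply _ (hs i)]

theorem gaussianReal_eq_withDensity (a : ℝ) {v s : ℝ≥0} (hv : v ≠ 0) (hs : s ≠ 0) :
    gaussianReal a v = (gaussianReal 0 s).withDensity fun z =>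
      ENNReal.ofReal (Real.exp
        (Real.log (s / v) / 2 + z ^ 2 / (2 * s) - (z - a) ^ 2 / (2 * v))) := by
  rw [gaussianReal_of_var_ne_zero _ hv, gaussianReal_of_var_ne_zero _ hs,
    ← withDensity_mul _ (measurable_gaussianPDF 0 s) (by fun_prop)]
  congr 1
  ext z
  rw [Pi.mul_apply, gaussianPDF, gaussianPDF, ← ENNReal.ofReal_mul (gaussianPDFReal_nonneg _ _ _),
    gaussianPDFReal_def, gaussianPDFReal_def]
  congr 1
  have hlog : Real.exp (Real.log (s / v) / 2) = √(s / v) := by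
    rw [Real.exp_half, Real.exp_log (by positivity)]
  have hsqrt : (√(2 * Real.pi * s))⁻¹ * √((s : ℝ) / v) = (√(2 * Real.pi * v))⁻¹ := by
    rw [← Real.sqrt_inv, ← Real.sqrt_inv, ← Real.sqrt_mul (by positivity)]
    congr 1
    field_simp
  rw [sub_eq_add_neg, Real.exp_add, Real.exp_add, hlog, ← hsqrt]
  have h1 : Real.exp (-(z - 0) ^ 2 / (2 * s)) * Real.exp (z ^ 2 / (2 * s)) = 1 := by
    rw [← Real.exp_add, ← Real.exp_zero]; congr 1; ring
  have h2 : -((z - a) ^ 2 / (2 * v)) = -(z - a) ^ 2 / (2 * v) := by ring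
  rw [h2]
  linear_combination (-(√(2 * Real.pi * s))⁻¹ * √((s : ℝ) / v) *
    Real.exp (-(z - a) ^ 2 / (2 * v))) * h1

/-- If, for each fixed `a`, the image of `D` under `F a` has density `f a` with respect to `Q`, then
the law of `(a, F a d)` under `π.prod D` has density `f` with respect to `π.prod Q`. -/
theorem map_prod_eq_withDensity {α β : Type*} [MeasurableSpace α] [MeasurableSpace β]
    (π : Measure α) [SFinite π] (D Q : Measure β) [SFinite D] [SFinite Q]
    {F : α → β → β} (hF : Measurable (Function.uncurry F))
    {f : α → β → ℝ≥0∞} (hf : Measurable (Function.uncurry f))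
    (h : ∀ a, D.map (F a) = Q.withDensity (f a)) :
    (π.prod D).map (fun w => (w.1, F w.1 w.2)) =
      (π.prod Q).withDensity (fun w => f w.1 w.2) := by
  have hFm : Measurable fun w : α × β => (w.1, F w.1 w.2) := measurable_fst.prodMk hF
  have hfm : Measurable fun w : α × β => f w.1 w.2 := hf
  ext s hs
  rw [Measure.map_apply hFm hs, Measure.prod_apply (hFm hs), withDensity_apply _ hs,
    ← lintegral_indicator hs, lintegral_prod _ (hfm.indicator hs).aemeasurable]
  refine lintegral_congr fun a => ?_
  have hsa : MeasurableSet (Prod.mk a ⁻¹' s) := measurable_prodMk_left hs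
  have hFa : Measurable (F a) := hF.comp measurable_prodMk_left
  calc D (Prod.mk a ⁻¹' ((fun w => (w.1, F w.1 w.2)) ⁻¹' s))
      = D.map (F a) (Prod.mk a ⁻¹' s) := (Measure.map_apply hFa hsa).symm
    _ = ∫⁻ y, (Prod.mk a ⁻¹' s).indicator (f a) y ∂Q := by
        rw [h, withDensity_apply _ hsa, lintegral_indicator hsa]

/-! ### Gaussian matrices -/

instance standardBorelSpace_realMatrix (m n : ℕ) : StandardBorelSpace (Matrix (Fin m) (Fin n) ℝ) :=
  inferInstanceAs (StandardBorelSpace (Fin m → Fin n → ℝ))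

instance isProbabilityMeasure_gaussianMatrix (m n : ℕ) (v : ℝ≥0) :
    IsProbabilityMeasure (gaussianMatrix m n v) :=
  inferInstanceAs (IsProbabilityMeasure
    (Measure.pi fun _ : Fin m => Measure.pi fun _ : Fin n => gaussianReal 0 v))

theorem measurable_matrix_entry {m n : ℕ} (i : Fin m) (j : Fin n) :
    Measurable fun M : Matrix (Fin m) (Fin n) ℝ => M i j :=
  (measurable_pi_apply j).comp (measurable_pi_apply i)

theorem measurable_of_matrix_entries {α : Type*} [MeasurableSpace α] {m n : ℕ}
    {F : α → Matrix (Fin m) (Fin n) ℝ} (h : ∀ i j, Measurable fun a => F a i j) : Measurable F :=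
  measurable_pi_lambda _ fun i => measurable_pi_lambda _ fun j => h i j

/-- The logarithm of the density at `Z` of the law of a matrix with independent entries
`N(A i j, v)` with respect to the law of a matrix with independent entries `N(0, s)`. -/
noncomputable def gaussianLogRatio {m p : ℕ} (v s : ℝ≥0) (A Z : Matrix (Fin m) (Fin p) ℝ) : ℝ :=
  ∑ i, ∑ j, (Real.log (s / v) / 2 + Z i j ^ 2 / (2 * s) - (Z i j - A i j) ^ 2 / (2 * v))

/-- Shifting and scaling a standard Gaussian matrix gives a law with density
`exp (gaussianLogRatio v s A)` with respect to the centred Gaussian matrix of entrywise variance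
`s`: the two laws are products over the entries, and so is the density. -/
theorem gaussianMatrix_map_const_add_smul {m p : ℕ} {v s : ℝ≥0} (hv : v ≠ 0) (hs : s ≠ 0) {γ : ℝ}
    (hγ : γ ^ 2 = v) (A : Matrix (Fin m) (Fin p) ℝ) :
    (gaussianMatrix m p 1).map (fun D => A + γ • D) =
      (gaussianMatrix m p s).withDensity fun Z =>
        ENNReal.ofReal (Real.exp (gaussianLogRatio v s A Z)) := by
  have hone : ∀ a : ℝ, (gaussianReal 0 1).map (fun x => a + γ * x) = gaussianReal a v := by
    intro a
    have : (fun x : ℝ => a + γ * x) = (fun x => a + x) ∘ fun x => γ * x := rfl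
    rw [this, ← Measure.map_map (by fun_prop) (by fun_prop), gaussianReal_map_const_mul,
      gaussianReal_map_const_add]
    congr 1
    · simp
    · ext; simp [hγ]
  have hrow : ∀ i, (Measure.pi fun _ : Fin p => gaussianReal 0 1).map
      (fun (x : Fin p → ℝ) (j : Fin p) => A i j + γ * x j) =
        Measure.pi fun j => gaussianReal (A i j) v := by
    intro i
    rw [Measure.pi_map_pi (f := fun j x => A i j + γ * x) fun j => by fun_prop]
    simp_rw [hone]
  let f : Fin m → Fin p → ℝ → ℝ≥0∞ := fun i j z => ENNReal.ofReal (Real.exp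
    (Real.log (s / v) / 2 + z ^ 2 / (2 * s) - (z - A i j) ^ 2 / (2 * v)))
  have hf : ∀ i j, Measurable (f i j) := fun i j => by fun_prop
  have hgauss : ∀ i j, gaussianReal (A i j) v = (gaussianReal 0 s).withDensity (f i j) :=
    fun i j => gaussianReal_eq_withDensity _ hv hs
  have hprob1 : ∀ i j, IsProbabilityMeasure ((gaussianReal 0 s).withDensity (f i j)) :=
    fun i j => hgauss i j ▸ inferInstance
  have hrow' : ∀ i, (Measure.pi fun j => gaussianReal (A i j) v) =
      (Measure.pi fun _ : Fin p => gaussianReal 0 s).withDensity fun x => ∏ j, f i j (x j) := by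
    intro i
    simp_rw [hgauss]
    exact pi_withDensity _ _ (hf i)
  have hprob2 : ∀ i, IsProbabilityMeasure
      ((Measure.pi fun _ : Fin p => gaussianReal 0 s).withDensity fun x => ∏ j, f i j (x j)) :=
    fun i => hrow' i ▸ inferInstance
  have hmat : (gaussianMatrix m p 1).map (fun D => A + γ • D) =
      Measure.pi fun i => (Measure.pi fun _ : Fin p => gaussianReal 0 1).map
        (fun (x : Fin p → ℝ) (j : Fin p) => A i j + γ * x j) :=
    Measure.pi_map_pi (μ := fun _ : Fin m => Measure.pi fun _ : Fin p => gaussianReal 0 1)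
      (f := fun i (x : Fin p → ℝ) (j : Fin p) => A i j + γ * x j) fun i =>
      (measurable_pi_lambda _ fun j =>
        ((measurable_pi_apply j).const_mul γ).const_add (A i j)).aemeasurable
  rw [hmat]
  simp_rw [hrow, hrow']
  rw [pi_withDensity _ _ fun i => by fun_prop]
  have hdens : (fun Z : Fin m → Fin p → ℝ => ∏ i, ∏ j, f i j (Z i j)) =
      fun Z => ENNReal.ofReal (Real.exp (gaussianLogRatio v s A Z)) := by
    ext Z
    simp_rw [gaussianLogRatio, Real.exp_sum]
    rw [ENNReal.ofReal_prod_of_nonneg fun i _ => by positivity]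
    refine Finset.prod_congr rfl fun i _ => ?_
    rw [ENNReal.ofReal_prod_of_nonneg fun i _ => by positivity]
  rw [hdens]
  rfl

/-! ### Moments of Gaussian matrices -/

theorem measurePreserving_gaussianMatrix_row {m n : ℕ} (v : ℝ≥0) (i : Fin m) :
    MeasurePreserving (fun M : Matrix (Fin m) (Fin n) ℝ => M i) (gaussianMatrix m n v)
      (Measure.pi fun _ => gaussianReal 0 v) :=
  measurePreserving_eval (fun _ : Fin m => Measure.pi fun _ : Fin n => gaussianReal 0 v) i

theorem measurePreserving_gaussianMatrix_entry {m n : ℕ} (v : ℝ≥0) (i : Fin m) (j : Fin n) :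
    MeasurePreserving (fun M : Matrix (Fin m) (Fin n) ℝ => M i j) (gaussianMatrix m n v)
      (gaussianReal 0 v) :=
  (measurePreserving_eval (fun _ : Fin n => gaussianReal 0 v) j).comp
    (measurePreserving_gaussianMatrix_row v i)

theorem memLp_gaussianMatrix_entry {m n : ℕ} (v : ℝ≥0) (i : Fin m) (j : Fin n) :
    MemLp (fun M : Matrix (Fin m) (Fin n) ℝ => M i j) 2 (gaussianMatrix m n v) :=
  (memLp_id_gaussianReal (μ := 0) (v := v) 2).comp_measurePreserving
    (measurePreserving_gaussianMatrix_entry v i j)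

theorem integral_gaussianMatrix_entry {m n : ℕ} (v : ℝ≥0) (i : Fin m) (j : Fin n) :
    ∫ M, M i j ∂gaussianMatrix m n v = 0 := by
  have h := measurePreserving_gaussianMatrix_entry v i j
  rw [← integral_id_gaussianReal (μ := 0) (v := v), ← h.map_eq,
    integral_map h.aemeasurable (by fun_prop)]

theorem integral_gaussianMatrix_entry_mul {m n : ℕ} (v : ℝ≥0) (i : Fin m) (k l : Fin n) :
    ∫ M, M i k * M i l ∂gaussianMatrix m n v = if k = l then (v : ℝ) else 0 := by
  split_ifs with hkl
  · subst hkl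
    have h := measurePreserving_gaussianMatrix_entry v i k
    have hvar := variance_eq_integral (X := fun x : ℝ => x) (μ := gaussianReal 0 v) (by fun_prop)
    rw [variance_fun_id_gaussianReal, integral_id_gaussianReal, ← h.map_eq,
      integral_map h.aemeasurable (by fun_prop)] at hvar
    rw [hvar]
    simp [sq]
  · have hrow := measurePreserving_gaussianMatrix_row (n := n) v i
    have hind := (iIndepFun_pi (μ := fun _ : Fin n => gaussianReal 0 v) (X := fun _ x => x)
      fun i => by fun_prop).indepFun hkl
    have h := hind.integral_fun_mul_eq_mul_integral
      (measurable_pi_apply k).aestronglyMeasurable (measurable_pi_apply l).aestronglyMeasurable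
    have hkl' : Measurable fun x : Fin n → ℝ => x k * x l :=
      (measurable_pi_apply k).mul (measurable_pi_apply l)
    rw [← hrow.map_eq, integral_map hrow.aemeasurable hkl'.aestronglyMeasurable,
      integral_map hrow.aemeasurable (measurable_pi_apply k).aestronglyMeasurable] at h
    rw [h, integral_gaussianMatrix_entry, zero_mul]

section Moments

variable {m n p : ℕ} {γ : ℝ} {μ : Measure (Matrix (Fin n) (Fin p) ℝ)}

theorem integrable_dataNoiseLaw_mul {f : Matrix (Fin n) (Fin p) ℝ → ℝ}
    {g : Matrix (Fin m) (Fin n) ℝ → ℝ} {h : Matrix (Fin m) (Fin p) ℝ → ℝ} (hf : Integrable f μ)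
    (hg : Integrable g (gaussianMatrix m n (1 / (n : ℝ≥0))))
    (hh : Integrable h (gaussianMatrix m p 1)) :
    Integrable (fun ω => f ω.1 * (g ω.2.1 * h ω.2.2)) (dataNoiseLaw m μ) :=
  hf.mul_prod (hg.mul_prod hh)

variable [IsProbabilityMeasure μ]

instance isProbabilityMeasure_dataNoiseLaw : IsProbabilityMeasure (dataNoiseLaw m μ) := by
  unfold dataNoiseLaw; infer_instance

theorem integral_dataNoiseLaw_mul (f : Matrix (Fin n) (Fin p) ℝ → ℝ)
    (g : Matrix (Fin m) (Fin n) ℝ → ℝ) (h : Matrix (Fin m) (Fin p) ℝ → ℝ) :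
    ∫ ω, f ω.1 * (g ω.2.1 * h ω.2.2) ∂dataNoiseLaw m μ =
      (∫ X, f X ∂μ) * ((∫ M, g M ∂gaussianMatrix m n (1 / (n : ℝ≥0))) *
        ∫ D, h D ∂gaussianMatrix m p 1) := by
  exact (integral_prod_mul f fun w : Matrix (Fin m) (Fin n) ℝ × Matrix (Fin m) (Fin p) ℝ =>
    g w.1 * h w.2).trans
    (congrArg _ (integral_prod_mul g h))

/-- Each entry of `Δ` has second moment `1`. -/
theorem noise_sq_moment (i : Fin m) (j : Fin p) :
    Integrable (fun ω => ω.2.2 i j ^ 2) (dataNoiseLaw m μ) ∧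
      ∫ ω, ω.2.2 i j ^ 2 ∂dataNoiseLaw m μ = 1 := by
  constructor
  · simpa using integrable_dataNoiseLaw_mul (μ := μ) (integrable_const 1) (integrable_const 1)
      (memLp_gaussianMatrix_entry 1 i j).integrable_sq
  · have h := integral_dataNoiseLaw_mul (m := m) (μ := μ) (fun _ => 1) (fun _ => 1)
      fun D => D i j * D i j
    rw [integral_gaussianMatrix_entry_mul] at h
    simpa [← sq] using h

/-- Since `X`, `Φ` and `Δ` are independent and the entries of `Φ` and `Δ` are centred and
independent, all cross terms in the square of `Z i j = ∑ k, Φ i k * X k j + γ * Δ i j` have mean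
zero. The entries of `X` may be dependent: `E[X k j * X l j]` with `k ≠ l` is multiplied by
`E[Φ i k * Φ i l] = 0`. -/
theorem compressedData_sq_moment (hX : ∀ i j, Integrable (fun X => X i j ^ 2) μ)
    (i : Fin m) (j : Fin p) :
    Integrable (fun ω => compressedData γ ω i j ^ 2) (dataNoiseLaw m μ) ∧
      ∫ ω, compressedData γ ω i j ^ 2 ∂dataNoiseLaw m μ =
        (1 / n : ℝ) * ∑ k, ∫ X, X k j ^ 2 ∂μ + γ ^ 2 := by
  have hL : ∀ k, MemLp (fun X : Matrix (Fin n) (Fin p) ℝ => X k j) 2 μ := fun k =>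
    (memLp_two_iff_integrable_sq (measurable_matrix_entry k j).aestronglyMeasurable).2 (hX k j)
  have hexp : ∀ ω : Matrix (Fin n) (Fin p) ℝ × Matrix (Fin m) (Fin n) ℝ × Matrix (Fin m) (Fin p) ℝ,
      compressedData γ ω i j ^ 2 =
      (∑ k, ∑ l, (ω.1 k j * ω.1 l j) * ((ω.2.1 i k * ω.2.1 i l) * 1)) +
      (2 * γ) * (∑ k, ω.1 k j * (ω.2.1 i k * ω.2.2 i j)) + γ ^ 2 * ω.2.2 i j ^ 2 := by
    intro ω
    have h1 : compressedData γ ω i j = (∑ k, ω.2.1 i k * ω.1 k j) + γ * ω.2.2 i j := by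
      simp [compressedData, Matrix.mul_apply]
    have h2 : (∑ k, ω.2.1 i k * ω.1 k j) ^ 2 =
        ∑ k, ∑ l, (ω.1 k j * ω.1 l j) * ((ω.2.1 i k * ω.2.1 i l) * 1) := by
      rw [sq, Finset.sum_mul_sum]
      exact Finset.sum_congr rfl fun k _ => Finset.sum_congr rfl fun l _ => by ring
    have h3 : (∑ k, ω.2.1 i k * ω.1 k j) * ω.2.2 i j =
        ∑ k, ω.1 k j * (ω.2.1 i k * ω.2.2 i j) := by
      rw [Finset.sum_mul]
      exact Finset.sum_congr rfl fun k _ => by ring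
    rw [h1, ← h2, ← h3]
    ring
  have hI1 : ∀ k l, Integrable (fun ω => (ω.1 k j * ω.1 l j) * ((ω.2.1 i k * ω.2.1 i l) * 1))
      (dataNoiseLaw m μ) := fun k l =>
    integrable_dataNoiseLaw_mul (f := fun X => X k j * X l j) (g := fun M => M i k * M i l)
      (h := fun _ => 1) ((hL k).integrable_mul (hL l))
      ((memLp_gaussianMatrix_entry _ i k).integrable_mul (memLp_gaussianMatrix_entry _ i l))
      (integrable_const 1)
  have hI2 : ∀ k, Integrable (fun ω => ω.1 k j * (ω.2.1 i k * ω.2.2 i j)) (dataNoiseLaw m μ) :=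
    fun k => integrable_dataNoiseLaw_mul (f := fun X => X k j) (g := fun M => M i k)
      (h := fun D => D i j) ((hL k).integrable one_le_two)
      ((memLp_gaussianMatrix_entry _ i k).integrable one_le_two)
      ((memLp_gaussianMatrix_entry _ i j).integrable one_le_two)
  have hI1' := integrable_finsetSum Finset.univ fun k _ =>
    integrable_finsetSum Finset.univ fun l _ => hI1 k l
  have hI2' := (integrable_finsetSum Finset.univ fun k _ => hI2 k).const_mul (2 * γ)
  have hI3 := (noise_sq_moment (μ := μ) i j).1.const_mul (γ ^ 2)
  have hE1 : ∀ k l, ∫ ω, (ω.1 k j * ω.1 l j) * ((ω.2.1 i k * ω.2.1 i l) * 1) ∂dataNoiseLaw m μ =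
      if k = l then (∫ X, X k j ^ 2 ∂μ) * (1 / n) else 0 := by
    intro k l
    have h := integral_dataNoiseLaw_mul (m := m) (μ := μ) (fun X => X k j * X l j)
      (fun M => M i k * M i l) fun _ => 1
    rw [h, integral_gaussianMatrix_entry_mul]
    split_ifs with hkl
    · subst hkl
      simp [sq]
    · simp
  have hE2 : ∀ k, ∫ ω, ω.1 k j * (ω.2.1 i k * ω.2.2 i j) ∂dataNoiseLaw m μ = 0 := by
    intro k
    have h := integral_dataNoiseLaw_mul (m := m) (μ := μ) (fun X => X k j)
      (fun M => M i k) fun D => D i j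
    rw [h, integral_gaussianMatrix_entry, zero_mul, mul_zero]
  have hI12 : Integrable (fun ω => (∑ k, ∑ l, (ω.1 k j * ω.1 l j) *
      ((ω.2.1 i k * ω.2.1 i l) * 1)) + (2 * γ) * (∑ k, ω.1 k j * (ω.2.1 i k * ω.2.2 i j)))
      (dataNoiseLaw m μ) := hI1'.add hI2'
  simp_rw [hexp]
  refine ⟨hI12.add hI3, ?_⟩
  rw [integral_add hI12 hI3, integral_add hI1' hI2', integral_const_mul,
    integral_const_mul, (noise_sq_moment i j).2,
    integral_finsetSum _ fun k _ => integrable_finsetSum Finset.univ fun l _ => hI1 k l,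
    integral_finsetSum _ fun k _ => hI2 k]
  simp_rw [integral_finsetSum Finset.univ fun l _ => hI1 _ l, hE1, hE2]
  simp [Finset.mul_sum, mul_comm]

end Moments

/-! ### The mutual information bound -/

section MutualInformation

variable {m n p : ℕ} {γ P : ℝ} {μ : Measure (Matrix (Fin n) (Fin p) ℝ)}

theorem measurable_compressedData : Measurable (compressedData (m := m) (n := n) (p := p) γ) := by
  refine measurable_of_matrix_entries fun i j => ?_
  simp only [compressedData, Matrix.add_apply, Matrix.mul_apply, Matrix.smul_apply]
  fun_prop

/-- Replacing the law of `Z` by any reference law `Q`, and then revealing `Φ` besides `X`, can only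
increase the divergence. -/
theorem mutualInfo_le_klDiv [IsProbabilityMeasure μ] (Q : Measure (Matrix (Fin m) (Fin p) ℝ))
    [IsProbabilityMeasure Q] :
    mutualInfo (dataNoiseLaw m μ) Prod.fst (compressedData γ) ≤
      InformationTheory.klDiv
        ((dataNoiseLaw m μ).map fun ω => ((ω.1, ω.2.1), compressedData γ ω))
        ((μ.prod (gaussianMatrix m n (1 / (n : ℝ≥0)))).prod Q) := by
  have hZ := measurable_compressedData (m := m) (n := n) (p := p) (γ := γ)
  have hXZ : Measurable fun ω : Matrix (Fin n) (Fin p) ℝ × Matrix (Fin m) (Fin n) ℝ ×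
      Matrix (Fin m) (Fin p) ℝ => (ω.1, compressedData γ ω) := measurable_fst.prodMk hZ
  have hXΦZ : Measurable fun ω : Matrix (Fin n) (Fin p) ℝ × Matrix (Fin m) (Fin n) ℝ ×
      Matrix (Fin m) (Fin p) ℝ => ((ω.1, ω.2.1), compressedData γ ω) :=
    (measurable_fst.prodMk measurable_snd.fst).prodMk hZ
  have hforget : Measurable fun w : (Matrix (Fin n) (Fin p) ℝ × Matrix (Fin m) (Fin n) ℝ) ×
      Matrix (Fin m) (Fin p) ℝ => (w.1.1, w.2) := measurable_fst.fst.prodMk measurable_snd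
  have hprob := Measure.isProbabilityMeasure_map (μ := dataNoiseLaw m μ) hXZ.aemeasurable
  have hfst : ((dataNoiseLaw m μ).map fun ω => (ω.1, compressedData γ ω)).fst = μ := by
    rw [Measure.fst_map_prodMk hZ]
    exact measurePreserving_fst.map_eq
  have hle := klDiv_fst_prod_snd_le
    ((dataNoiseLaw m μ).map fun ω => (ω.1, compressedData γ ω)) Q
  have hdata := InformationTheory.klDiv_map_le
    ((dataNoiseLaw m μ).map fun ω => ((ω.1, ω.2.1), compressedData γ ω))
    ((μ.prod (gaussianMatrix m n (1 / (n : ℝ≥0)))).prod Q) hforget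
  have hR : ((μ.prod (gaussianMatrix m n (1 / (n : ℝ≥0)))).prod Q).map
      (fun w => (w.1.1, w.2)) = μ.prod Q :=
    (measurePreserving_fst.prod (MeasurePreserving.id Q)).map_eq
  rw [Measure.map_map hforget hXΦZ, hR] at hdata
  rw [hfst, Measure.snd_map_prodMk measurable_fst] at hle
  rw [mutualInfo]
  have hX : (dataNoiseLaw m μ).map Prod.fst = μ := measurePreserving_fst.map_eq
  rw [hX]
  exact hle.trans hdata

theorem measurable_gaussianLogRatio {α : Type*} [MeasurableSpace α] (v s : ℝ≥0)
    {A Z : α → Matrix (Fin m) (Fin p) ℝ} (hA : Measurable A) (hZ : Measurable Z) :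
    Measurable fun a => gaussianLogRatio v s (A a) (Z a) := by
  have hA' : ∀ i j, Measurable fun a => A a i j := fun i j => (measurable_matrix_entry i j).comp hA
  have hZ' : ∀ i j, Measurable fun a => Z a i j := fun i j => (measurable_matrix_entry i j).comp hZ
  unfold gaussianLogRatio
  fun_prop

/-- Given `(X, Φ)`, the data `Z` is Gaussian with mean `Φ X` and entrywise variance `γ ^ 2`; hence
the joint law of `((X, Φ), Z)` has an explicit density with respect to the product of the law of
`(X, Φ)` and a centred Gaussian law. -/
theorem map_compressedData_eq_withDensity [IsProbabilityMeasure μ] {v s : ℝ≥0} (hv : v ≠ 0)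
    (hs : s ≠ 0) (hγ : γ ^ 2 = v) :
    ((dataNoiseLaw m μ).map fun ω => ((ω.1, ω.2.1), compressedData γ ω)) =
      ((μ.prod (gaussianMatrix m n (1 / (n : ℝ≥0)))).prod
        (gaussianMatrix m p s)).withDensity fun w =>
          ENNReal.ofReal (Real.exp (gaussianLogRatio v s (w.1.2 * w.1.1) w.2)) := by
  have hmul : Measurable fun w : (Matrix (Fin n) (Fin p) ℝ × Matrix (Fin m) (Fin n) ℝ) ×
      Matrix (Fin m) (Fin p) ℝ => w.1.2 * w.1.1 := by
    refine measurable_of_matrix_entries fun i j => ?_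
    simp only [Matrix.mul_apply]
    fun_prop
  have hadd : Measurable fun w : (Matrix (Fin n) (Fin p) ℝ × Matrix (Fin m) (Fin n) ℝ) ×
      Matrix (Fin m) (Fin p) ℝ => w.1.2 * w.1.1 + γ • w.2 := by
    refine measurable_of_matrix_entries fun i j => ?_
    simp only [Matrix.mul_apply, Matrix.add_apply, Matrix.smul_apply]
    fun_prop
  have h := map_prod_eq_withDensity (μ.prod (gaussianMatrix m n (1 / (n : ℝ≥0))))
    (gaussianMatrix m p 1) (gaussianMatrix m p s)
    (F := fun w D => w.2 * w.1 + γ • D)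
    (f := fun w Z => ENNReal.ofReal (Real.exp (gaussianLogRatio v s (w.2 * w.1) Z)))
    hadd (measurable_gaussianLogRatio v s hmul measurable_snd).exp.ennreal_ofReal
    fun w => gaussianMatrix_map_const_add_smul hv hs hγ (w.2 * w.1)
  rw [← h, ← (measurePreserving_prodAssoc μ _ _).symm.map_eq,
    Measure.map_map (measurable_fst.prodMk hadd) (MeasurableEquiv.measurable _)]
  rfl

/-- The reference law for `Z` has entrywise variance `P + γ ^ 2`, the largest average variance that
the power constraint allows; each of the `m * p` entries then contributes at most the capacity
`log (1 + P / γ ^ 2) / 2` of a scalar Gaussian channel. -/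
theorem mutualInfo_compressedData_le (hγ : 0 < γ) (hP : 0 ≤ P) (hμ : PowerConstrained P μ) :
    mutualInfo (dataNoiseLaw m μ) Prod.fst (compressedData γ) ≤
      ENNReal.ofReal ((m : ℝ) * (p : ℝ) * (Real.log (1 + P / γ ^ 2) / 2)) := by
  have := hμ.isProbabilityMeasure
  set v : ℝ≥0 := (γ ^ 2).toNNReal
  set s : ℝ≥0 := (P + γ ^ 2).toNNReal
  have hv : (v : ℝ) = γ ^ 2 := Real.coe_toNNReal _ (by positivity)
  have hs : (s : ℝ) = P + γ ^ 2 := Real.coe_toNNReal _ (by positivity)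
  have hv0 : v ≠ 0 := by rw [← NNReal.coe_ne_zero, hv]; positivity
  have hs0 : s ≠ 0 := by rw [← NNReal.coe_ne_zero, hs]; positivity
  have hZ := measurable_compressedData (m := m) (n := n) (p := p) (γ := γ)
  have hXΦZ : Measurable fun ω : Matrix (Fin n) (Fin p) ℝ × Matrix (Fin m) (Fin n) ℝ ×
      Matrix (Fin m) (Fin p) ℝ => ((ω.1, ω.2.1), compressedData γ ω) :=
    (measurable_fst.prodMk measurable_snd.fst).prodMk hZ
  have hprob := Measure.isProbabilityMeasure_map (μ := dataNoiseLaw m μ) hXΦZ.aemeasurable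
  have hg : Measurable fun w : (Matrix (Fin n) (Fin p) ℝ × Matrix (Fin m) (Fin n) ℝ) ×
      Matrix (Fin m) (Fin p) ℝ => gaussianLogRatio v s (w.1.2 * w.1.1) w.2 := by
    refine measurable_gaussianLogRatio v s (measurable_of_matrix_entries fun i j => ?_)
      measurable_snd
    simp only [Matrix.mul_apply]
    fun_prop
  have hratio : ∀ ω : Matrix (Fin n) (Fin p) ℝ × Matrix (Fin m) (Fin n) ℝ ×
      Matrix (Fin m) (Fin p) ℝ, gaussianLogRatio v s (ω.2.1 * ω.1) (compressedData γ ω) =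
        ∑ i, ∑ j, (Real.log (s / v) / 2 + (1 / (2 * s)) * compressedData γ ω i j ^ 2 -
          (1 / 2) * ω.2.2 i j ^ 2) := by
    intro ω
    refine Finset.sum_congr rfl fun i _ => Finset.sum_congr rfl fun j _ => ?_
    have hd : compressedData γ ω i j - (ω.2.1 * ω.1) i j = γ * ω.2.2 i j := by
      simp [compressedData]
    rw [hd, hv]
    field_simp
  have hz := fun i j => compressedData_sq_moment (m := m) (γ := γ) hμ.integrable_sq i j
  have hd := fun i j => noise_sq_moment (m := m) (μ := μ) i j
  have hterm : ∀ i j, Integrable (fun ω => Real.log (s / v) / 2 +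
      (1 / (2 * s)) * compressedData γ ω i j ^ 2 - (1 / 2) * ω.2.2 i j ^ 2)
      (dataNoiseLaw m μ) := fun i j =>
    ((integrable_const _).add ((hz i j).1.const_mul _)).sub ((hd i j).1.const_mul _)
  have hint : Integrable (fun ω => gaussianLogRatio v s (ω.2.1 * ω.1) (compressedData γ ω))
      (dataNoiseLaw m μ) := by
    simp_rw [hratio]
    exact integrable_finsetSum _ fun i _ => integrable_finsetSum _ fun j _ => hterm i j
  refine (mutualInfo_le_klDiv (gaussianMatrix m p s)).trans ?_
  rw [klDiv_withDensity_exp _ _ hg (map_compressedData_eq_withDensity hv0 hs0 hv.symm)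
    ((integrable_map_measure hg.aestronglyMeasurable hXΦZ.aemeasurable).2 hint),
    integral_map hXΦZ.aemeasurable hg.aestronglyMeasurable]
  refine ENNReal.ofReal_le_ofReal ?_
  simp_rw [hratio]
  rw [integral_finsetSum _ fun i _ => integrable_finsetSum _ fun j _ => hterm i j]
  simp_rw [integral_finsetSum Finset.univ fun j _ => hterm _ j]
  have hle : ∀ i j, ∫ ω, (Real.log (s / v) / 2 +
      (1 / (2 * s)) * compressedData γ ω i j ^ 2 - (1 / 2) * ω.2.2 i j ^ 2) ∂dataNoiseLaw m μ ≤
      Real.log (1 + P / γ ^ 2) / 2 := by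
    intro i j
    have hsum : Integrable (fun ω => Real.log (s / v) / 2 +
        (1 / (2 * s)) * compressedData γ ω i j ^ 2) (dataNoiseLaw m μ) :=
      (integrable_const _).add ((hz i j).1.const_mul _)
    rw [integral_sub hsum ((hd i j).1.const_mul _),
      integral_add (integrable_const _) ((hz i j).1.const_mul _), integral_const_mul,
      integral_const_mul, (hz i j).2, (hd i j).2, integral_const, probReal_univ, one_smul]
    have hlog : (s : ℝ) / v = 1 + P / γ ^ 2 := by
      rw [hs, hv, add_div, div_self (by positivity), add_comm]
    -- The choice `s = P + γ ^ 2` makes this term cancel against half the noise moment.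
    have hpow : 1 / (2 * (s : ℝ)) * ((1 / n : ℝ) * ∑ k, ∫ X, X k j ^ 2 ∂μ + γ ^ 2) ≤ 1 / 2 := by
      rw [div_mul_eq_mul_div, one_mul, div_le_div_iff₀ (by positivity) two_pos]
      linarith [hμ.power_le j]
    rw [hlog]
    linarith
  refine (Finset.sum_le_sum fun i _ => Finset.sum_le_sum fun j _ => hle i j).trans_eq ?_
  simp [mul_assoc]

end MutualInformation

theorem mainTheorem3 (m n p : ℕ) (hn : 0 < n) (hp : 0 < p) (γ P : ℝ) (hγ : 0 < γ) (hP : 0 ≤ P) :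
    informationRate m n p γ P ≤
      ENNReal.ofReal (((m : ℝ) / (n : ℝ)) * Real.log (1 + P / γ ^ 2)) := by
  refine iSup₂_le fun μ hμ => ?_
  have hlog : 0 ≤ Real.log (1 + P / γ ^ 2) := Real.log_nonneg (by simp; positivity)
  have hn' : (0 : ℝ) < n := by exact_mod_cast hn
  refine ENNReal.div_le_of_le_mul ((mutualInfo_compressedData_le hγ hP hμ).trans ?_)
  rw [← ENNReal.ofReal_natCast n, ← ENNReal.ofReal_natCast p, ← ENNReal.ofReal_mul hn'.le,
    ← ENNReal.ofReal_mul (by positivity)]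
  refine ENNReal.ofReal_le_ofReal ?_
  have hmul : (m : ℝ) / n * Real.log (1 + P / γ ^ 2) * (n * p) =
      m * p * Real.log (1 + P / γ ^ 2) := by
    field_simp
  rw [hmul]
  -- The mutual information bound is half of what is needed.
  gcongr
  linarith
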